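/- Let $K$ be one of the fields $\mathbb{Q}$, $\mathbb{Q}(\sqrt{-1})$, $\mathbb{Q}(\sqrt{-2})$. Let $D$ be the discriminant of $K$, $r_1$ and $r_2$ its numbers of real and complex places, $h$ its class number, $R$ its regulator, $w$ its number of roots of unity, $\zeta_K$ its Dedekind zeta function, and put $$c_K=\frac{2^{r_1}(2\pi)^{r_2}hR}{w},\qquad Z_K(s)=\bigl(\pi^{-s/2}\Gamma(s/2)\bigr)^{r_1}\bigl((2\pi)^{1-s}\Gamma(s)\bigr)^{r_2}\zeta_K(s)\quad(\operatorname{Re}s>1).$$ Then the function $c_K^{-1}s(s-1)|D|^{s/2}Z_K(s)$ extends (uniquely) from $\operatorname{Re}s>1$ to an entire function $\xi_K$, the Dedekind xi function of $K$, and there is a random variable $X$ with values in $(0,\infty)$, whose law has a density with respect to Lebesgue measure, such that for every $s\in\mathbb{C}$ the variable $X^s$ is integrable and $$\mathbb{E}(X^s)=|D|^{-s/2}\,\xi_K(s).$$ -/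

import Mathlib

noncomputable section

namespace DedekindXi

open NumberField

variable (K : Type*) [Field K] [NumberField K]

/-- The complex Gamma factor `Γ_ℂ(s) = (2π)^(1-s) Γ(s)`. In this normalization it is `π` times
Mathlib's `Complex.Gammaℂ`. The real Gamma factor is Mathlib's
`Complex.Gammaℝ s = π^(-s/2) Γ(s/2)`. -/
def gammaC (s : ℂ) : ℂ := (2 * (Real.pi : ℂ)) ^ (1 - s) * Complex.Gamma s

/-- The function `Z_K(s) = Γ_ℝ(s)^{r₁} Γ_ℂ(s)^{r₂} ζ_K(s)`, to be used for `Re s > 1` only, where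
`NumberField.dedekindZeta` is the value of an absolutely convergent Dirichlet series. -/
def completedZeta (s : ℂ) : ℂ :=
  Complex.Gammaℝ s ^ InfinitePlace.nrRealPlaces K *
    gammaC s ^ InfinitePlace.nrComplexPlaces K * dedekindZeta K s

/-- The constant `c_K = 2^{r₁} (2π)^{r₂} h R / w`. -/
def residueConst : ℝ :=
  2 ^ InfinitePlace.nrRealPlaces K * (2 * Real.pi) ^ InfinitePlace.nrComplexPlaces K *
    classNumber K * Units.regulator K / Units.torsionOrder K

/-- `ξ` is an entire function with `ξ(s) = c_K⁻¹ s (s-1) |D|^{s/2} Z_K(s)` for `Re s > 1`. -/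
structure IsXi (ξ : ℂ → ℂ) : Prop where
  entire : Differentiable ℂ ξ
  eq_of_one_lt_re : ∀ s : ℂ, 1 < s.re →
    ξ s = (residueConst K : ℂ)⁻¹ * (s * (s - 1)) * ((|discr K| : ℤ) : ℂ) ^ (s / 2) *
      completedZeta K s

/-- There is at most one such entire function. -/
theorem IsXi.unique {ξ₁ ξ₂ : ℂ → ℂ} (h₁ : IsXi K ξ₁) (h₂ : IsXi K ξ₂) : ξ₁ = ξ₂ := by
  refine AnalyticOnNhd.eq_of_eventuallyEq (𝕜 := ℂ) (z₀ := 2)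
    (fun z _ => h₁.entire.analyticAt z) (fun z _ => h₂.entire.analyticAt z) ?_
  have ho : IsOpen {s : ℂ | 1 < s.re} := isOpen_lt continuous_const Complex.continuous_re
  filter_upwards [ho.mem_nhds (show (2 : ℂ) ∈ {s : ℂ | 1 < s.re} by simp)] with s hs
  rw [h₁.eq_of_one_lt_re s hs, h₂.eq_of_one_lt_re s hs]

open scoped Classical in
/-- The Dedekind xi function `ξ_K`: the entire continuation of
`c_K⁻¹ s (s-1) |D|^{s/2} Z_K(s)` (and the zero function if there were no such continuation). -/
def xi : ℂ → ℂ :=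
  if h : ∃ ξ : ℂ → ℂ, IsXi K ξ then h.choose else 0

end DedekindXi

end

/-! For these fields the ring of integers is principal and the unit group finite, so `w ζ_K(s)` is
the sum of `|N a|^(-s)` over nonzero integers `a`, and the norm is `n` or `x² + d y²` with `d = 1,
2`. Put `p = π n²`, `r = 1/2`, respectively `p = 2π(x² + d y²)`, `r = 1`; up to elementary factors
the xi function is then `s(s-1) Γ(rs) ∑ p^(-rs)`.

Let `Θ(t) = 1 + ∑ exp(-p t)` and `δ = t d/dt`. Jacobi's identity gives `Θ(C/t) = A t^r Θ(t)`. The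
kernel is `δ(δ + r)Θ`: applying `δ(δ + r)` removes the constant term and multiplies the Mellin
transform by `u(u - r)`, which at `u = rs` is `r² s(s-1)` (`hasMellin_kernel`). The substitution `t
↦ C/t` exchanges the two factors up to sign, so the kernel obeys the same reflection law as `Θ`
(`kernel_reflection`). Positivity therefore has to be checked only for `t ≥ √C`, where it holds term
by term because `p √C ≥ 1 + r` (`kernel_nonneg`).

Reflection and positivity make every Mellin integral of the kernel converge, and `∫ kernel dt/t = r`
(`integral_kernel_div`). Hence `kernel/(r t)` is a probability density, and `X = t^r` under it has
the required moments for `Re s > 1`. The moments are entire in `s`, so they provide the continuation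
as well, and uniqueness of the continuation identifies them with the xi function everywhere. -/

namespace DedekindXi

open Set Filter Topology MeasureTheory NumberField

/-! ### Exponential series: termwise derivatives and Mellin transforms -/

section

/-- A single term of the exponential series bounds `exp y` from below. Degree `n + 2` is used so
that every series below is majorized by `∑ p⁻²`. -/
theorem pow_mul_exp_neg_le (n : ℕ) {y : ℝ} (hy : 0 < y) :
    y ^ n * Real.exp (-y) ≤ (n + 2).factorial * (y ^ 2)⁻¹ := by
  have h := Real.pow_div_factorial_le_exp y hy.le (n + 2)
  have hf : (0 : ℝ) < (n + 2).factorial := by exact_mod_cast Nat.factorial_pos _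
  rw [div_le_iff₀ hf] at h
  rw [Real.exp_neg, ← div_eq_mul_inv, ← div_eq_mul_inv,
    div_le_div_iff₀ (Real.exp_pos y) (by positivity), ← pow_add]
  linarith

variable {ι : Type*} (p : ι → ℝ)

/-- The series `∑ (pᵢ t)ⁿ exp (-pᵢ t)`. -/
noncomputable def expSeries (n : ℕ) (t : ℝ) : ℝ := ∑' i, (p i * t) ^ n * Real.exp (-(p i * t))

variable {p}

theorem expTerm_le (hp : ∀ i, 0 < p i) (n : ℕ) {t : ℝ} (ht : 0 < t) (i : ι) :
    (p i * t) ^ n * Real.exp (-(p i * t)) ≤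
      (n + 2).factorial * (t ^ 2)⁻¹ * (p i ^ 2)⁻¹ := by
  refine (pow_mul_exp_neg_le n (mul_pos (hp i) ht)).trans_eq ?_
  rw [mul_pow, mul_inv]; ring

theorem summable_expTerm (hp : ∀ i, 0 < p i) (hs : Summable fun i => (p i ^ 2)⁻¹) (n : ℕ) {t : ℝ}
    (ht : 0 < t) : Summable fun i => (p i * t) ^ n * Real.exp (-(p i * t)) := by
  refine Summable.of_nonneg_of_le (fun i => ?_) (expTerm_le hp n ht)
    (hs.mul_left ((n + 2).factorial * (t ^ 2)⁻¹ : ℝ))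
  have := hp i
  positivity

theorem expSeries_nonneg (hp : ∀ i, 0 < p i) (n : ℕ) {t : ℝ} (ht : 0 < t) :
    0 ≤ expSeries p n t :=
  tsum_nonneg fun i => by have := hp i; positivity

theorem expSeries_le (hp : ∀ i, 0 < p i) (hs : Summable fun i => (p i ^ 2)⁻¹) (n : ℕ) {t : ℝ}
    (ht : 0 < t) :
    expSeries p n t ≤ (n + 2).factorial * (t ^ 2)⁻¹ * ∑' i, (p i ^ 2)⁻¹ := by
  rw [← tsum_mul_left]
  exact (summable_expTerm hp hs n ht).tsum_le_tsum (expTerm_le hp n ht) (hs.mul_left _)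

/-- The operator `t d/dt` sends `y^n e^(-y)`, `y = p t`, to `n y^n e^(-y) - y^(n+1) e^(-y)`. -/
theorem hasDerivAt_expSeries (hp : ∀ i, 0 < p i) (hs : Summable fun i => (p i ^ 2)⁻¹) (n : ℕ)
    {t : ℝ} (ht : 0 < t) :
    HasDerivAt (expSeries p n) ((n * expSeries p n t - expSeries p (n + 1) t) / t) t := by
  -- The bound on the derivative of a term at `z` decreases in `z`; its value at `t / 2` serves on
  -- all of `(t / 2, ∞)`.
  set M : ℝ := (n * (n + 2).factorial + (n + 1 + 2).factorial) * ((t / 2) ^ 2)⁻¹ / (t / 2) with hM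
  have key : HasDerivAt (fun z => ∑' i, (p i * z) ^ n * Real.exp (-(p i * z)))
      (∑' i, (n * ((p i * t) ^ n * Real.exp (-(p i * t))) -
        (p i * t) ^ (n + 1) * Real.exp (-(p i * t))) / t) t := by
    refine hasDerivAt_tsum_of_isPreconnected (u := fun i => M * (p i ^ 2)⁻¹)
      (g' := fun i z => (n * ((p i * z) ^ n * Real.exp (-(p i * z))) -
        (p i * z) ^ (n + 1) * Real.exp (-(p i * z))) / z)
      (hs.mul_left _) (isOpen_Ioi (a := t / 2)) isPreconnected_Ioi ?_ ?_ (y₀ := t)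
      (by simpa using ht) (summable_expTerm hp hs n ht) (by simpa using ht)
    · intro i z hz
      have hz0 : 0 < z := (half_pos ht).trans hz
      have h1 : HasDerivAt (fun z => p i * z) (p i) z := by
        simpa using (hasDerivAt_id z).const_mul (p i)
      have h2 := (h1.pow n).mul h1.neg.exp
      refine h2.congr_deriv ?_
      simp only [Pi.neg_apply, Pi.pow_apply]
      rcases n with _ | n
      · simp
        field_simp
      · simp
        field_simp
        ring
    · intro i z hz
      have hz' : t / 2 < z := hz
      have ht2 : 0 < t / 2 := half_pos ht
      have hz0 : 0 < z := ht2.trans hz'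
      have hpi := hp i
      have e1 := expTerm_le hp n hz0 i
      have e2 := expTerm_le hp (n + 1) hz0 i
      have a1 : 0 ≤ (p i * z) ^ n * Real.exp (-(p i * z)) := by positivity
      have a2 : 0 ≤ (p i * z) ^ (n + 1) * Real.exp (-(p i * z)) := by positivity
      rw [norm_div, Real.norm_of_nonneg hz0.le]
      have : ‖n * ((p i * z) ^ n * Real.exp (-(p i * z))) -
          (p i * z) ^ (n + 1) * Real.exp (-(p i * z))‖ ≤
          (n * (n + 2).factorial + (n + 1 + 2).factorial) * (z ^ 2)⁻¹ * (p i ^ 2)⁻¹ := by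
        refine (norm_sub_le _ _).trans ?_
        rw [Real.norm_of_nonneg a2, Real.norm_of_nonneg (by positivity)]
        have := mul_le_mul_of_nonneg_left e1 (Nat.cast_nonneg (α := ℝ) n)
        linarith
      refine (div_le_div_of_nonneg_right this hz0.le).trans ?_
      rw [hM, mul_div_right_comm]
      gcongr
  refine key.congr_deriv ?_
  rw [tsum_div_const, (((summable_expTerm hp hs n ht).mul_left _)).tsum_sub
    (summable_expTerm hp hs (n + 1) ht), tsum_mul_left]
  rfl

theorem continuousOn_expSeries (hp : ∀ i, 0 < p i) (hs : Summable fun i => (p i ^ 2)⁻¹) (n : ℕ) :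
    ContinuousOn (expSeries p n) (Ioi 0) :=
  fun _ ht => (hasDerivAt_expSeries hp hs n ht).continuousAt.continuousWithinAt

theorem hasMellin_expSeries [Countable ι] [Nonempty ι] (hp : ∀ i, 0 < p i)
    (hs2 : Summable fun i => (p i ^ 2)⁻¹) (n : ℕ) {u : ℂ} (hu : 0 < u.re)
    (hs : Summable fun i => (p i) ^ (-u.re)) :
    HasMellin (fun t => (expSeries p n t : ℂ)) u
      (Complex.Gamma (u + n) * ∑' i, (p i : ℂ) ^ (-u)) := by
  have value : ∀ v : ℂ, v.re = u.re →
      HasSum (fun i => Complex.Gamma (v + n) * (p i : ℂ) ^ (-v))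
        (mellin (fun t => (expSeries p n t : ℂ)) v) := by
    intro v hv
    -- The factor `p^n` goes into the coefficients, and `t^n` into a shift of the exponent by `n`.
    have h := hasSum_mellin (a := fun i => (p i : ℂ) ^ n) (p := p) (s := v + n)
      (F := fun t => (t : ℂ) ^ (-(n : ℂ)) • (expSeries p n t : ℂ)) (fun i => Or.inr (hp i))
      (by simp only [Complex.add_re, Complex.natCast_re, hv]; positivity) ?_ ?_
    · rw [mellin_cpow_smul, add_neg_cancel_right] at h
      refine h.congr_fun ?_
      intro i
      have : (p i : ℂ) ≠ 0 := by exact_mod_cast (hp i).ne'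
      rw [Complex.cpow_add _ _ this, Complex.cpow_natCast, Complex.cpow_neg]
      have h2 : (p i : ℂ) ^ v ≠ 0 := by simp [Complex.cpow_eq_zero_iff, this]
      field_simp
    · intro t ht
      have ht : 0 < t := ht
      have h1 := (summable_expTerm hp hs2 n ht).hasSum
      have h2 := (Complex.hasSum_ofReal.mpr h1).mul_left ((t : ℂ) ^ (-(n : ℂ)))
      refine h2.congr_fun fun i => ?_
      have : (t : ℂ) ≠ 0 := by exact_mod_cast ht.ne'
      rw [Complex.cpow_neg, Complex.cpow_natCast]
      push_cast
      rw [mul_pow, neg_mul]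
      field_simp
    · refine hs.congr fun i => ?_
      have := hp i
      rw [Complex.add_re, Complex.natCast_re, hv, Real.rpow_add this, Real.rpow_natCast, norm_pow,
        Complex.norm_real, Real.norm_of_nonneg this.le, Real.rpow_neg this.le]
      have := (Real.rpow_pos_of_pos this u.re).ne'
      field_simp
  have meas : AEStronglyMeasurable (fun t => (expSeries p n t : ℂ)) (volume.restrict (Ioi 0)) :=
    (Complex.continuous_ofReal.comp_continuousOn
      (continuousOn_expSeries hp hs2 n)).aestronglyMeasurable measurableSet_Ioi
  have conv : MellinConvergent (fun t => (expSeries p n t : ℂ)) (u.re : ℂ) := by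
    have h := (value (u.re : ℂ) (by simp)).tsum_eq
    rw [tsum_mul_left] at h
    -- The summation formula alone does not give convergence. At the real exponent its value is
    -- nonzero, whereas a divergent Bochner integral would be `0`.
    refine Integrable.of_integral_ne_zero (fun h0 => ?_)
    rw [mellin, h0] at h
    have hG : Complex.Gamma ((u.re : ℂ) + n) ≠ 0 :=
      Complex.Gamma_ne_zero_of_re_pos (by simp; positivity)
    have hsum : ∑' i, (p i : ℂ) ^ (-(u.re : ℂ)) = ((∑' i, (p i) ^ (-u.re) : ℝ) : ℂ) := by
      rw [Complex.ofReal_tsum]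
      refine tsum_congr fun i => ?_
      rw [Complex.ofReal_cpow (hp i).le]
      push_cast
      rfl
    have hpos : 0 < ∑' i, (p i) ^ (-u.re) :=
      hs.tsum_pos (fun i => Real.rpow_nonneg (hp i).le _) (Classical.arbitrary ι)
        (Real.rpow_pos_of_pos (hp _) _)
    rw [hsum] at h
    exact mul_ne_zero hG (by exact_mod_cast hpos.ne') h
  refine ⟨?_, ?_⟩
  · rw [MellinConvergent, mellin_convergent_iff_norm subset_rfl measurableSet_Ioi meas] at conv ⊢
    simpa using conv
  · rw [← (value u rfl).tsum_eq, tsum_mul_left]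

end

/-! ### The kernel: reflection, positivity, Mellin transform, total mass -/

section

/-- Apply `δ = t d/dt` to both sides: on the left `δ` changes sign under `t ↦ C / t`, on the right
moving it past `t ^ r` turns it into `δ + r`. -/
theorem log_deriv_reflection {h h₁ k k₁ : ℝ → ℝ} {C A r : ℝ} (hC : 0 < C)
    (hd : ∀ t, 0 < t → HasDerivAt h (h₁ t / t) t) (kd : ∀ t, 0 < t → HasDerivAt k (k₁ t / t) t)
    (fe : ∀ t, 0 < t → h (C / t) = A * t ^ r * k t) {t : ℝ} (ht : 0 < t) :
    -h₁ (C / t) = A * t ^ r * (r * k t + k₁ t) := by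
  have hCt : 0 < C / t := div_pos hC ht
  have e1 : HasDerivAt (fun t => h (C / t)) (h₁ (C / t) / (C / t) * (-C / t ^ 2)) t := by
    have : HasDerivAt (fun t : ℝ => C / t) (-C / t ^ 2) t := by
      simpa [div_eq_mul_inv] using (hasDerivAt_inv ht.ne').const_mul C
    exact (hd _ hCt).comp t this
  have e2 : HasDerivAt (fun t => A * t ^ r * k t)
      (A * (r * t ^ (r - 1)) * k t + A * t ^ r * (k₁ t / t)) t :=
    ((Real.hasDerivAt_rpow_const (Or.inl ht.ne')).const_mul A).mul (kd t ht)
  have e3 : HasDerivAt (fun t => A * t ^ r * k t)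
      (h₁ (C / t) / (C / t) * (-C / t ^ 2)) t := by
    refine e1.congr_of_eventuallyEq ?_
    filter_upwards [Ioi_mem_nhds ht] with z hz using (fe z hz).symm
  have e4 := e2.unique e3
  rw [Real.rpow_sub_one ht.ne'] at e4
  field_simp at e4
  linarith

variable {ι : Type*}

/-- A sequence of positive numbers whose theta series `1 + ∑ exp (-pᵢ t)` satisfies a functional
equation relating `t` and `C / t`, with all `pᵢ` large enough for its second order
differential `t ↦ ∑ (pᵢ t) (pᵢ t - (1 + r)) exp (-pᵢ t)` to be nonnegative. -/
structure IsThetaSeq (p : ι → ℝ) (r C A : ℝ) : Prop where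
  pos : ∀ i, 0 < p i
  r_pos : 0 < r
  r_le_one : r ≤ 1
  C_pos : 0 < C
  A_pos : 0 < A
  summable : ∀ σ, r < σ → Summable fun i => p i ^ (-σ)
  theta_reflection : ∀ t, 0 < t →
    1 + expSeries p 0 (C / t) = A * t ^ r * (1 + expSeries p 0 t)
  large : ∀ i, 1 + r ≤ p i * √C

/-- The kernel `∑ ((pᵢ t)² - (1 + r) pᵢ t) exp (-pᵢ t)`. -/
noncomputable def kernel (p : ι → ℝ) (r t : ℝ) : ℝ := expSeries p 2 t - (1 + r) * expSeries p 1 t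

namespace IsThetaSeq

variable {p : ι → ℝ} {r C A : ℝ} (H : IsThetaSeq p r C A)
include H

theorem summable_inv_sq : Summable fun i => (p i ^ 2)⁻¹ := by
  refine (H.summable 2 (by linarith [H.r_le_one])).congr fun i => ?_
  rw [Real.rpow_neg (H.pos i).le, Real.rpow_two]

theorem reflection_one {t : ℝ} (ht : 0 < t) :
    expSeries p 1 (C / t) = A * t ^ r * (r * (1 + expSeries p 0 t) - expSeries p 1 t) := by
  have hd : ∀ t, 0 < t → HasDerivAt (fun t => 1 + expSeries p 0 t) ((-expSeries p 1 t) / t) t := by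
    intro t ht
    simpa using (hasDerivAt_expSeries H.pos H.summable_inv_sq 0 ht).const_add 1
  have := log_deriv_reflection H.C_pos hd hd
    H.theta_reflection ht
  linarith

/-- Here `r(1 + E₀) - E₁` is `(δ + r)Θ`, so the kernel is `δ(δ + r)Θ`. -/
theorem hasDerivAt_primitive {t : ℝ} (ht : 0 < t) :
    HasDerivAt (fun t => r * (1 + expSeries p 0 t) - expSeries p 1 t) (kernel p r t / t) t := by
  have h0 := hasDerivAt_expSeries H.pos H.summable_inv_sq 0 ht
  have h1 := hasDerivAt_expSeries H.pos H.summable_inv_sq 1 ht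
  refine (((h0.const_add 1).const_mul r).sub h1).congr_deriv ?_
  simp only [kernel, Nat.cast_zero, Nat.cast_one]
  ring

/-- Two uses of `log_deriv_reflection`: `δ(δ + r)` becomes `(δ + r)δ`, the two signs cancelling. -/
theorem kernel_reflection {t : ℝ} (ht : 0 < t) :
    kernel p r (C / t) = A * t ^ r * kernel p r t := by
  have h1 : ∀ t, 0 < t → HasDerivAt (expSeries p 1)
      ((expSeries p 1 t - expSeries p 2 t) / t) t := fun t ht => by
    simpa using hasDerivAt_expSeries H.pos H.summable_inv_sq 1 ht
  have h2 := log_deriv_reflection H.C_pos h1 (fun t ht => H.hasDerivAt_primitive ht)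
    (fun t ht => H.reflection_one ht) ht
  have h3 := H.reflection_one ht
  rw [kernel, show expSeries p 2 (C / t) - (1 + r) * expSeries p 1 (C / t) =
    -(expSeries p 1 (C / t) - expSeries p 2 (C / t)) - r * expSeries p 1 (C / t) by ring, h2, h3]
  ring

/-- Each term is `y(y - (1 + r))e^(-y)` with `y = p t`, nonnegative for `t ≥ √C`; the reflection
carries this to `t ≤ √C`. -/
theorem kernel_nonneg {t : ℝ} (ht : 0 < t) : 0 ≤ kernel p r t := by
  have hC := Real.sqrt_pos.mpr H.C_pos
  have key : ∀ t, √C ≤ t → 0 ≤ kernel p r t := by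
    intro t htC
    have ht : 0 < t := hC.trans_le htC
    have s1 := summable_expTerm H.pos H.summable_inv_sq 1 ht
    have s2 := summable_expTerm H.pos H.summable_inv_sq 2 ht
    rw [kernel, expSeries, expSeries, ← tsum_mul_left, ← s2.tsum_sub (s1.mul_left _)]
    refine tsum_nonneg fun i => ?_
    have h1 : 1 + r ≤ p i * t :=
      (H.large i).trans (mul_le_mul_of_nonneg_left htC (H.pos i).le)
    have h2 : 0 < p i * t := mul_pos (H.pos i) ht
    rw [show (p i * t) ^ 2 * Real.exp (-(p i * t)) - (1 + r) * ((p i * t) ^ 1 * Real.exp (-(p i * t)))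
      = (p i * t) * (p i * t - (1 + r)) * Real.exp (-(p i * t)) by ring]
    have : 0 ≤ p i * t - (1 + r) := by linarith
    positivity
  rcases le_total (√C) t with h | h
  · exact key t h
  · have h1 : √C ≤ C / t := by
      rw [le_div_iff₀ ht]
      calc √C * t ≤ √C * √C := by gcongr
        _ = C := Real.mul_self_sqrt H.C_pos.le
    have h2 := key _ h1
    rw [H.kernel_reflection ht] at h2
    exact nonneg_of_mul_nonneg_right h2 (mul_pos H.A_pos (Real.rpow_pos_of_pos ht r))

theorem continuousOn_kernel : ContinuousOn (kernel p r) (Ioi 0) :=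
  (continuousOn_expSeries H.pos H.summable_inv_sq 2).sub
    ((continuousOn_expSeries H.pos H.summable_inv_sq 1).const_smul (1 + r))

theorem hasMellin_kernel [Countable ι] [Nonempty ι] {u : ℂ} (hu : r < u.re) :
    HasMellin (fun t => (kernel p r t : ℂ)) u
      (u * (u - r) * Complex.Gamma u * ∑' i, (p i : ℂ) ^ (-u)) := by
  have hu0 : 0 < u.re := H.r_pos.trans hu
  have h2 := hasMellin_expSeries H.pos H.summable_inv_sq 2 hu0 (H.summable _ hu)
  have h1 := hasMellin_expSeries H.pos H.summable_inv_sq 1 hu0 (H.summable _ hu)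
  have h3 := hasMellin_const_smul h1.1 (1 + r : ℂ)
  have h4 := hasMellin_sub h2.1 h3.1
  have hu' : u ≠ 0 := fun h => by simp [h] at hu0
  have hu1 : u + 1 ≠ 0 := fun h => by
    have := congrArg Complex.re h
    simp at this; linarith
  have hG1 : Complex.Gamma (u + 1) = u * Complex.Gamma u := Complex.Gamma_add_one u hu'
  have hG2 : Complex.Gamma (u + 2) = (u + 1) * (u * Complex.Gamma u) := by
    rw [← hG1, ← Complex.Gamma_add_one _ hu1]; congr 1; ring
  rw [h3.2, h2.2, h1.2] at h4
  convert h4 using 1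
  · funext t; simp [kernel]
  · push_cast
    rw [hG1, hG2, smul_eq_mul]; ring

/-- The substitution `t ↦ C / t` exchanges the exponents `u` and `r - u`. -/
theorem mellinConvergent_kernel_neg [Countable ι] [Nonempty ι] {u : ℂ} (hu : u.re < 0) :
    MellinConvergent (fun t => (kernel p r t : ℂ)) u := by
  have h := (H.hasMellin_kernel (u := -u + r) (by simp; linarith)).1
  have h2 := (MellinConvergent.comp_mul_left (f := fun t => (kernel p r t : ℂ)) (s := -u + r)
    H.C_pos).mpr h
  have h3 : MellinConvergent (fun t => (kernel p r (C * t ^ (-1 : ℝ)) : ℂ)) (u - r) := by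
    refine (MellinConvergent.comp_rpow (f := fun t => (kernel p r (C * t) : ℂ)) (s := u - r)
      (a := -1) (by norm_num)).mpr ?_
    convert h2 using 1
    push_cast; ring
  have h4 : MellinConvergent (fun t => (t : ℂ) ^ (r : ℂ) • (kernel p r t : ℂ)) (u - r) := by
    refine ((h3.const_smul ((A : ℂ)⁻¹)).congr_fun (fun t ht => ?_) measurableSet_Ioi)
    have ht : 0 < t := ht
    have hA : (A : ℂ) ≠ 0 := by exact_mod_cast H.A_pos.ne'
    simp only [smul_eq_mul]
    rw [Real.rpow_neg_one, ← div_eq_mul_inv, H.kernel_reflection ht, Complex.ofReal_mul,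
      Complex.ofReal_mul, Complex.ofReal_cpow ht.le]
    field_simp
  have := MellinConvergent.cpow_smul.mp h4
  simpa using this

theorem integrableOn_rpow_mul_kernel [Countable ι] [Nonempty ι] (σ : ℝ) :
    IntegrableOn (fun t => t ^ (σ - 1) * kernel p r t) (Ioi 0) := by
  have meas : AEStronglyMeasurable (fun t => (kernel p r t : ℂ)) (volume.restrict (Ioi 0)) :=
    (Complex.continuous_ofReal.comp_continuousOn
      H.continuousOn_kernel).aestronglyMeasurable measurableSet_Ioi
  have toReal : ∀ u : ℝ, MellinConvergent (fun t => (kernel p r t : ℂ)) u →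
      IntegrableOn (fun t => t ^ (u - 1) * kernel p r t) (Ioi 0) := by
    intro u hu
    rw [MellinConvergent, mellin_convergent_iff_norm subset_rfl measurableSet_Ioi meas] at hu
    refine hu.congr_fun (fun t ht => ?_) measurableSet_Ioi
    simp [abs_of_nonneg (H.kernel_nonneg ht)]
  -- Two exponents on either side of the strip `0 ≤ Re u ≤ r`, and of `σ`. Since the kernel is
  -- nonnegative, the sum of the two integrands dominates the one at `σ`.
  have h1 := toReal (-|σ| - 1) (H.mellinConvergent_kernel_neg (by simp; linarith [abs_nonneg σ]))
  have h2 := toReal (|σ| + 2)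
    (H.hasMellin_kernel (by simp; linarith [abs_nonneg σ, H.r_le_one])).1
  refine (h1.add h2).mono' ?_ ?_
  · refine ContinuousOn.aestronglyMeasurable ?_ measurableSet_Ioi
    exact (ContinuousOn.rpow_const continuousOn_id fun t ht => Or.inl (ne_of_gt ht)).mul
      H.continuousOn_kernel
  · filter_upwards [ae_restrict_mem measurableSet_Ioi] with t ht
    have ht : 0 < t := ht
    have hk := H.kernel_nonneg ht
    rw [Real.norm_of_nonneg (mul_nonneg (Real.rpow_nonneg ht.le _) hk), Pi.add_apply, ← add_mul]
    refine mul_le_mul_of_nonneg_right ?_ hk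
    have p1 := Real.rpow_nonneg ht.le (-|σ| - 1 - 1)
    have p2 := Real.rpow_nonneg ht.le (|σ| + 2 - 1)
    rcases le_total t 1 with h | h
    · have := Real.rpow_le_rpow_of_exponent_ge ht h
        (show -|σ| - 1 - 1 ≤ σ - 1 by linarith [neg_abs_le σ])
      linarith
    · have := Real.rpow_le_rpow_of_exponent_le h
        (show σ - 1 ≤ |σ| + 2 - 1 by linarith [le_abs_self σ])
      linarith

theorem tendsto_rpow_mul_expSeries (n : ℕ) {a : ℝ} (ha : a < 2) :
    Tendsto (fun t => t ^ a * expSeries p n t) atTop (𝓝 0) := by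
  have h : Tendsto (fun t : ℝ => ((n + 2).factorial * ∑' i, (p i ^ 2)⁻¹) * t ^ (-(2 - a))) atTop
      (𝓝 (((n + 2).factorial * ∑' i, (p i ^ 2)⁻¹) * 0)) :=
    (tendsto_rpow_neg_atTop (by linarith)).const_mul _
  rw [mul_zero] at h
  refine squeeze_zero' ?_ ?_ h
  · filter_upwards [eventually_gt_atTop 0] with t ht
    exact mul_nonneg (Real.rpow_nonneg ht.le _) (expSeries_nonneg H.pos n ht)
  · filter_upwards [eventually_gt_atTop 0] with t ht
    refine (mul_le_mul_of_nonneg_left (expSeries_le H.pos H.summable_inv_sq n ht)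
      (Real.rpow_nonneg ht.le a)).trans_eq ?_
    rw [neg_sub, Real.rpow_sub ht, Real.rpow_two]
    field_simp

/-- The primitive `(δ + r)Θ` tends to `r` at infinity, where only the constant term survives, and to
`0` at `0`. -/
theorem integral_kernel_div [Countable ι] [Nonempty ι] :
    ∫ t in Ioi 0, kernel p r t / t = r := by
  set J : ℝ → ℝ := fun t => r * (1 + expSeries p 0 t) - expSeries p 1 t with hJ
  have top : Tendsto J atTop (𝓝 r) := by
    have h0 := H.tendsto_rpow_mul_expSeries 0 (a := 0) (by norm_num)
    have h1 := H.tendsto_rpow_mul_expSeries 1 (a := 0) (by norm_num)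
    simp only [Real.rpow_zero, one_mul] at h0 h1
    simpa using ((h0.const_add 1).const_mul r).sub h1
  -- By `reflection_one`, `J t` is a constant times `(C/t)^r E₁(C/t)`, and `E₁` decays at least like
  -- the inverse square while `r < 2`.
  have bot : Tendsto J (𝓝[>] 0) (𝓝 0) := by
    have h1 := H.tendsto_rpow_mul_expSeries 1 (a := r) (by linarith [H.r_le_one])
    have h2 : Tendsto (fun t : ℝ => C / t) (𝓝[>] 0) atTop := by
      simpa [div_eq_mul_inv] using tendsto_inv_nhdsGT_zero.const_mul_atTop H.C_pos
    have h3 := (h1.comp h2).const_mul ((A * C ^ r)⁻¹)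
    rw [mul_zero] at h3
    refine h3.congr' ?_
    filter_upwards [self_mem_nhdsWithin] with t ht
    have ht : 0 < t := ht
    have hA := H.A_pos.ne'
    have hC := (Real.rpow_pos_of_pos H.C_pos r).ne'
    have htr := (Real.rpow_pos_of_pos ht r).ne'
    simp only [Function.comp_apply]
    rw [H.reflection_one ht, Real.div_rpow H.C_pos.le ht.le]
    field_simp
    rfl
  -- The value at `0` is reset to the limit, as the fundamental theorem needs continuity at the
  -- endpoint.
  set J' : ℝ → ℝ := fun t => if t ≤ 0 then 0 else J t with hJ'
  have eqJ : ∀ t, 0 < t → J' t = J t := fun t ht => by simp [hJ', not_le.mpr ht]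
  have h := integral_Ioi_of_hasDerivAt_of_tendsto (f := J') (f' := fun t => kernel p r t / t)
    (a := 0) (m := r) ?_ ?_ ?_ ?_
  · simpa [hJ'] using h
  · rw [← continuousWithinAt_Ioi_iff_Ici, ContinuousWithinAt]
    simp only [hJ', le_refl, if_true]
    refine bot.congr' ?_
    filter_upwards [self_mem_nhdsWithin] with t ht
    exact (eqJ t ht).symm
  · intro t ht
    refine (H.hasDerivAt_primitive ht).congr_of_eventuallyEq ?_
    filter_upwards [Ioi_mem_nhds ht] with z hz using eqJ z hz
  · refine (H.integrableOn_rpow_mul_kernel 0).congr_fun (fun t ht => ?_) measurableSet_Ioi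
    simp only [zero_sub, Real.rpow_neg_one]
    rw [mul_comm, div_eq_mul_inv]
  · refine top.congr' ?_
    filter_upwards [eventually_gt_atTop 0] with t ht using (eqJ t ht).symm

end IsThetaSeq

end

/-! ### The random variable and its moments -/

/-- The density on `(0, ∞)` whose moments are given by the kernel. -/
noncomputable def kernelLaw {ι : Type*} (p : ι → ℝ) (r : ℝ) : Measure ℝ :=
  (volume.restrict (Ioi 0)).withDensity fun t => ENNReal.ofReal (kernel p r t / (r * t))

/-- The function `t ↦ t ^ r` on `(0, ∞)`, extended by `1`. -/
noncomputable def posRpow (r t : ℝ) : ℝ := if 0 < t then t ^ r else 1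

theorem posRpow_pos (r t : ℝ) : 0 < posRpow r t := by
  unfold posRpow
  split_ifs with h
  · exact Real.rpow_pos_of_pos h r
  · exact one_pos

theorem measurable_posRpow (r : ℝ) : Measurable (posRpow r) :=
  Measurable.ite measurableSet_Ioi (measurable_id.pow_const r) measurable_const

theorem ofReal_cpow_eq_exp {x : ℝ} (hx : 0 < x) (s : ℂ) :
    (x : ℂ) ^ s = Complex.exp (s * (Real.log x : ℝ)) := by
  rw [Complex.cpow_def_of_ne_zero (by exact_mod_cast hx.ne'), Complex.ofReal_log hx.le, mul_comm]

namespace IsThetaSeq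

variable {ι : Type*} {p : ι → ℝ} {r C A : ℝ} (H : IsThetaSeq p r C A)
include H

theorem aemeasurable_density :
    AEMeasurable (fun t => ENNReal.ofReal (kernel p r t / (r * t))) (volume.restrict (Ioi 0)) := by
  refine (ContinuousOn.aemeasurable ?_ measurableSet_Ioi).ennreal_ofReal
  exact H.continuousOn_kernel.div (continuousOn_const.mul continuousOn_id)
    fun t ht => (mul_pos H.r_pos ht).ne'

/-- On `(0, ∞)` the preimage of a null set lies in its image under the differentiable map `y ↦ y ^
r⁻¹`, hence is null. -/
theorem map_posRpow_kernelLaw_absolutelyContinuous :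
    ((kernelLaw p r).map (posRpow r)).AbsolutelyContinuous volume := by
  refine Measure.AbsolutelyContinuous.mk fun s hs h0 => ?_
  rw [Measure.map_apply (measurable_posRpow r) hs]
  refine withDensity_absolutelyContinuous _ _ ?_
  rw [Measure.restrict_apply (measurable_posRpow r hs)]
  have hr := H.r_pos
  refine measure_mono_null (t := (fun y : ℝ => y ^ r⁻¹) '' (s ∩ Ioi 0)) ?_ ?_
  · rintro t ⟨h1, h2⟩
    have h2 : 0 < t := h2
    rw [mem_preimage, posRpow, if_pos h2] at h1
    exact ⟨t ^ r, ⟨h1, Real.rpow_pos_of_pos h2 r⟩, Real.rpow_rpow_inv h2.le hr.ne'⟩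
  · refine addHaar_image_eq_zero_of_differentiableOn_of_addHaar_eq_zero volume ?_
      (measure_mono_null inter_subset_left h0)
    intro y hy
    exact (Real.differentiableAt_rpow_const_of_ne _ (ne_of_gt hy.2)).differentiableWithinAt

theorem density_smul_posRpow {t : ℝ} (ht : 0 < t) (s : ℂ) :
    (ENNReal.ofReal (kernel p r t / (r * t))).toReal • (posRpow r t : ℂ) ^ s =
      (r : ℂ)⁻¹ * ((t : ℂ) ^ (r * s - 1) • (kernel p r t : ℂ)) := by
  have ht' : (t : ℂ) ≠ 0 := by exact_mod_cast ht.ne'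
  have hr : (r : ℂ) ≠ 0 := by exact_mod_cast H.r_pos.ne'
  rw [ENNReal.toReal_ofReal (div_nonneg (H.kernel_nonneg ht) (mul_pos H.r_pos ht).le), posRpow,
    if_pos ht, ofReal_cpow_eq_exp (Real.rpow_pos_of_pos ht r), Real.log_rpow ht,
    Complex.cpow_sub _ _ ht', Complex.cpow_one, ofReal_cpow_eq_exp ht, Complex.real_smul]
  push_cast
  rw [show s * (r * (Real.log t : ℂ)) = r * s * (Real.log t : ℂ) by ring, smul_eq_mul]
  field_simp

theorem mellinConvergent_kernel [Countable ι] [Nonempty ι] (u : ℂ) :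
    MellinConvergent (fun t => (kernel p r t : ℂ)) u := by
  have meas : AEStronglyMeasurable (fun t => (kernel p r t : ℂ)) (volume.restrict (Ioi 0)) :=
    (Complex.continuous_ofReal.comp_continuousOn
      H.continuousOn_kernel).aestronglyMeasurable measurableSet_Ioi
  rw [MellinConvergent, mellin_convergent_iff_norm subset_rfl measurableSet_Ioi meas]
  refine (H.integrableOn_rpow_mul_kernel u.re).congr_fun (fun t ht => ?_) measurableSet_Ioi
  simp [abs_of_nonneg (H.kernel_nonneg ht)]

theorem integrable_posRpow_cpow [Countable ι] [Nonempty ι] (s : ℂ) :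
    Integrable (fun t => (posRpow r t : ℂ) ^ s) (kernelLaw p r) := by
  rw [kernelLaw, integrable_withDensity_iff_integrable_smul₀' H.aemeasurable_density (by simp)]
  exact IntegrableOn.congr_fun ((H.mellinConvergent_kernel (r * s)).const_mul (r : ℂ)⁻¹)
    (fun t ht => (H.density_smul_posRpow ht s).symm) measurableSet_Ioi

theorem integral_posRpow_cpow (s : ℂ) :
    ∫ t, (posRpow r t : ℂ) ^ s ∂kernelLaw p r =
      (r : ℂ)⁻¹ * mellin (fun t => (kernel p r t : ℂ)) (r * s) := by
  rw [kernelLaw, integral_withDensity_eq_integral_toReal_smul₀ H.aemeasurable_density (by simp),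
    setIntegral_congr_fun measurableSet_Ioi fun t ht => H.density_smul_posRpow ht s,
    integral_const_mul, mellin]

theorem isProbabilityMeasure_kernelLaw [Countable ι] [Nonempty ι] :
    IsProbabilityMeasure (kernelLaw p r) := by
  refine ⟨?_⟩
  rw [kernelLaw, withDensity_apply _ MeasurableSet.univ, Measure.restrict_univ,
    ← ofReal_integral_eq_lintegral_ofReal]
  · have : ∫ t in Ioi 0, kernel p r t / (r * t) = 1 := by
      simp_rw [mul_comm r, ← div_div]
      rw [integral_div, H.integral_kernel_div, div_self H.r_pos.ne']
    rw [this, ENNReal.ofReal_one]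
  · refine IntegrableOn.congr_fun ((H.integrableOn_rpow_mul_kernel 0).const_mul r⁻¹)
      (fun t ht => ?_) measurableSet_Ioi
    have ht : 0 < t := ht
    have hr := H.r_pos
    simp only [zero_sub, Real.rpow_neg_one]
    field_simp
  · filter_upwards [ae_restrict_mem measurableSet_Ioi] with t ht
    exact div_nonneg (H.kernel_nonneg ht) (mul_pos H.r_pos ht).le

/-- The moment function is the complex moment generating function of `log X`, which is analytic
everywhere because all real moments are finite. -/
theorem differentiable_moment [Countable ι] [Nonempty ι] :
    Differentiable ℂ fun s : ℂ => ∫ t, (posRpow r t : ℂ) ^ s ∂kernelLaw p r := by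
  have h1 : (fun s : ℂ => ∫ t, (posRpow r t : ℂ) ^ s ∂kernelLaw p r) =
      ProbabilityTheory.complexMGF (fun t => Real.log (posRpow r t)) (kernelLaw p r) := by
    funext s
    simp_rw [ProbabilityTheory.complexMGF, ofReal_cpow_eq_exp (posRpow_pos r _)]
  have h2 : ProbabilityTheory.integrableExpSet (fun t => Real.log (posRpow r t))
      (kernelLaw p r) = univ := by
    refine eq_univ_of_forall fun x => ?_
    have := (H.integrable_posRpow_cpow x).norm
    refine this.congr (Eventually.of_forall fun t => ?_)
    simp only [ofReal_cpow_eq_exp (posRpow_pos r t), Complex.norm_exp]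
    simp
  intro s
  rw [h1]
  exact (ProbabilityTheory.hasDerivAt_complexMGF (by simp [h2])).differentiableAt

theorem moment_eq [Countable ι] [Nonempty ι] {s : ℂ} (hs : 1 < s.re) :
    ∫ t, (posRpow r t : ℂ) ^ s ∂kernelLaw p r =
      r * (s * (s - 1)) * Complex.Gamma (r * s) * ∑' i, (p i : ℂ) ^ (-(r * s)) := by
  have hr : (r : ℂ) ≠ 0 := by exact_mod_cast H.r_pos.ne'
  rw [H.integral_posRpow_cpow, (H.hasMellin_kernel (u := r * s) ?_).2]
  · field_simp
  · simpa using mul_lt_mul_of_pos_left hs H.r_pos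

end IsThetaSeq

/-- If the Dirichlet series attached to a theta sequence is the completed zeta function of `K`,
then the xi function of `K` is a Mellin transform of a positive random variable. -/
theorem IsThetaSeq.exists_random_variable (K : Type*) [Field K] [NumberField K]
    {ι : Type*} [Countable ι] [Nonempty ι] {p : ι → ℝ} {r C A : ℝ} (H : IsThetaSeq p r C A)
    (hz : ∀ s : ℂ, 1 < s.re → (residueConst K : ℂ)⁻¹ * completedZeta K s =
      r * Complex.Gamma (r * s) * ∑' i, (p i : ℂ) ^ (-(r * s))) :
    IsXi K (xi K) ∧
    ∃ (Ω : Type) (_ : MeasurableSpace Ω) (P : Measure Ω) (X : Ω → ℝ),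
      IsProbabilityMeasure P ∧ Measurable X ∧ (∀ ω, 0 < X ω) ∧
      (P.map X).AbsolutelyContinuous volume ∧
      ∀ s : ℂ, Integrable (fun ω => (X ω : ℂ) ^ s) P ∧
        ∫ ω, (X ω : ℂ) ^ s ∂P = ((|NumberField.discr K| : ℤ) : ℂ) ^ (-s / 2) * xi K s := by
  have hD : ((|NumberField.discr K| : ℤ) : ℂ) ≠ 0 := by
    exact_mod_cast abs_ne_zero.mpr (NumberField.discr_ne_zero K)
  have hx : IsXi K fun s => ((|NumberField.discr K| : ℤ) : ℂ) ^ (s / 2) *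
      ∫ t, (posRpow r t : ℂ) ^ s ∂kernelLaw p r := by
    refine ⟨?_, fun s hs => ?_⟩
    · refine Differentiable.mul (fun s => ?_) H.differentiable_moment
      exact (differentiableAt_id.div_const 2).const_cpow (Or.inl hD)
    · rw [H.moment_eq hs]
      linear_combination (-s * (s - 1) * ((|NumberField.discr K| : ℤ) : ℂ) ^ (s / 2)) * hz s hs
  have hxi : IsXi K (xi K) := by
    have h : ∃ ξ : ℂ → ℂ, IsXi K ξ := ⟨_, hx⟩
    rw [xi, dif_pos h]
    exact h.choose_spec
  refine ⟨hxi, ℝ, inferInstance, kernelLaw p r, posRpow r, H.isProbabilityMeasure_kernelLaw,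
    measurable_posRpow r, posRpow_pos r, H.map_posRpow_kernelLaw_absolutelyContinuous,
    fun s => ⟨H.integrable_posRpow_cpow s, ?_⟩⟩
  rw [hxi.unique K hx, ← mul_assoc, ← Complex.cpow_add _ _ hD, neg_div, neg_add_cancel,
    Complex.cpow_zero, one_mul]

/-! ### Theta sequences of the integers and of the forms `x² + d y²` -/

theorem one_add_expSeries_zero {α : Type*} {q : α → ℝ} {a : α} (ha : q a = 0) {t : ℝ}
    (hs : Summable fun i : {x : α // x ≠ a} => Real.exp (-(q i * t))) :
    (Summable fun x => Real.exp (-(q x * t))) ∧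
    1 + expSeries (fun i : {x : α // x ≠ a} => q i) 0 t = ∑' x, Real.exp (-(q x * t)) := by
  have h : Summable fun x => Real.exp (-(q x * t)) :=
    (Set.finite_singleton a).summable_compl_iff.mp hs
  refine ⟨h, ?_⟩
  rw [← h.tsum_subtype_add_tsum_subtype_compl {a},
    tsum_singleton a (fun x => Real.exp (-(q x * t))), ha, zero_mul, neg_zero, Real.exp_zero, expSeries]
  simp only [pow_zero, one_mul]
  rfl

/-- The Gaussian sum `∑ exp (-π t n²)` over all integers. -/
noncomputable def gaussSum (t : ℝ) : ℝ := ∑' n : ℤ, Real.exp (-(Real.pi * (n : ℝ) ^ 2 * t))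

theorem gaussSum_inv {t : ℝ} (ht : 0 < t) : gaussSum (1 / t) = √t * gaussSum t := by
  have h := Real.tsum_exp_neg_mul_int_sq ht
  have h1 : ∀ n : ℤ, Real.exp (-Real.pi * t * (n : ℝ) ^ 2) =
    Real.exp (-(Real.pi * (n : ℝ) ^ 2 * t)) := fun n => by congr 1; ring
  have h2 : ∀ n : ℤ, Real.exp (-Real.pi / t * (n : ℝ) ^ 2) =
    Real.exp (-(Real.pi * (n : ℝ) ^ 2 * (1 / t))) := fun n => by congr 1; ring
  simp_rw [h1, h2, ← Real.sqrt_eq_rpow] at h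
  rw [gaussSum, gaussSum, h, ← mul_assoc, mul_one_div_cancel (Real.sqrt_pos.mpr ht).ne', one_mul]

theorem summable_int_rpow {σ : ℝ} (hσ : 1 / 2 < σ) :
    Summable fun n : {n : ℤ // n ≠ 0} => (Real.pi * (n : ℝ) ^ 2) ^ (-σ) := by
  have h := (Real.summable_abs_int_rpow (b := 2 * σ) (by linarith)).mul_left (Real.pi ^ (-σ))
  refine (h.comp_injective (Subtype.val_injective (p := fun n : ℤ => n ≠ 0))).congr fun n => ?_
  simp only [Function.comp_apply]
  rw [Real.mul_rpow Real.pi_pos.le (sq_nonneg _), ← sq_abs, ← Real.rpow_two,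
    ← Real.rpow_mul (abs_nonneg _)]
  ring_nf

theorem int_seq_pos (n : {n : ℤ // n ≠ 0}) : 0 < Real.pi * (n : ℝ) ^ 2 := by
  have : (n : ℝ) ≠ 0 := by exact_mod_cast n.2
  have := Real.pi_pos
  positivity

theorem summable_int_exp {t : ℝ} (ht : 0 < t) :
    Summable fun n : {n : ℤ // n ≠ 0} => Real.exp (-(Real.pi * (n : ℝ) ^ 2 * t)) := by
  have h := summable_expTerm int_seq_pos
    ((summable_int_rpow (σ := 2) (by norm_num)).congr fun n => by
      rw [Real.rpow_neg (int_seq_pos n).le, Real.rpow_two]) 0 ht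
  simpa using h

theorem isThetaSeq_int :
    IsThetaSeq (fun n : {n : ℤ // n ≠ 0} => Real.pi * (n : ℝ) ^ 2) (1 / 2) 1 1 where
  pos := int_seq_pos
  r_pos := by norm_num
  r_le_one := by norm_num
  C_pos := one_pos
  A_pos := one_pos
  summable _ hσ := summable_int_rpow hσ
  theta_reflection t ht := by
    have key : ∀ t, 0 < t →
        1 + expSeries (fun n : {n : ℤ // n ≠ 0} => Real.pi * (n : ℝ) ^ 2) 0 t = gaussSum t :=
      fun t ht => (one_add_expSeries_zero (q := fun n : ℤ => Real.pi * (n : ℝ) ^ 2) (a := 0)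
        (by simp) (summable_int_exp ht)).2
    rw [key _ ht, key _ (by positivity), gaussSum_inv ht, one_mul, ← Real.sqrt_eq_rpow]
  large n := by
    have h1 : (1 : ℝ) ≤ (n : ℝ) ^ 2 := by
      have hn := n.2
      have : 0 < (n : ℤ) ^ 2 := by positivity
      exact_mod_cast this
    have := Real.pi_gt_three
    rw [Real.sqrt_one]
    nlinarith

theorem form_pos {d : ℝ} (hd : 0 < d) (x : {x : ℤ × ℤ // x ≠ 0}) :
    0 < 2 * Real.pi * ((x.1.1 : ℝ) ^ 2 + d * (x.1.2 : ℝ) ^ 2) := by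
  have hpi := Real.pi_pos
  obtain ⟨⟨a, b⟩, hx⟩ := x
  have h : a ≠ 0 ∨ b ≠ 0 := by
    by_contra! h
    exact hx (by simp [h.1, h.2])
  rcases h with h | h
  · have : (a : ℝ) ≠ 0 := by exact_mod_cast h
    positivity
  · have : (b : ℝ) ≠ 0 := by exact_mod_cast h
    positivity

theorem one_le_form {d : ℝ} (hd : 1 ≤ d) (x : {x : ℤ × ℤ // x ≠ 0}) :
    1 ≤ (x.1.1 : ℝ) ^ 2 + d * (x.1.2 : ℝ) ^ 2 := by
  have h := form_pos one_pos x
  have h1 : 0 < x.1.1 ^ 2 + x.1.2 ^ 2 := by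
    have h2 := pos_of_mul_pos_right h (by positivity)
    rw [one_mul] at h2
    exact_mod_cast h2
  have h2 : (1 : ℝ) ≤ (x.1.1 : ℝ) ^ 2 + (x.1.2 : ℝ) ^ 2 := by exact_mod_cast h1
  nlinarith [sq_nonneg (x.1.2 : ℝ)]

/-- The form dominates the square of the sup norm on `ℤ²`, which reduces the claim to the lattice
sum used for Eisenstein series. -/
theorem summable_form_rpow {d σ : ℝ} (hd : 1 ≤ d) (hσ : 1 < σ) :
    Summable fun x : {x : ℤ × ℤ // x ≠ 0} =>
      (2 * Real.pi * ((x.1.1 : ℝ) ^ 2 + d * (x.1.2 : ℝ) ^ 2)) ^ (-σ) := by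
  have h := EisensteinSeries.summable_one_div_norm_rpow (k := 2 * σ) (by linarith)
  rw [← (finTwoArrowEquiv ℤ).symm.summable_iff] at h
  have h := h.comp_injective (Subtype.val_injective (p := fun x : ℤ × ℤ => x ≠ 0))
  refine Summable.of_nonneg_of_le (fun x => Real.rpow_nonneg (form_pos (by linarith) x).le _)
    (fun x => ?_) h
  simp only [Function.comp_apply]
  set y := (finTwoArrowEquiv ℤ).symm x.1 with hy
  have hy0 : 0 < ‖y‖ := by
    rw [norm_pos_iff]
    intro h0
    refine x.2 ((finTwoArrowEquiv ℤ).symm.injective ?_)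
    rw [← hy, h0]
    funext i
    fin_cases i <;> rfl
  have hle : ‖y‖ ^ 2 ≤ 2 * Real.pi * ((x.1.1 : ℝ) ^ 2 + d * (x.1.2 : ℝ) ^ 2) := by
    have h1 : ‖y‖ ^ 2 ≤ (x.1.1 : ℝ) ^ 2 + (x.1.2 : ℝ) ^ 2 := by
      rw [← Real.le_sqrt hy0.le (by positivity), pi_norm_le_iff_of_nonneg (Real.sqrt_nonneg _)]
      intro i
      rw [Int.norm_eq_abs]
      apply Real.abs_le_sqrt
      fin_cases i
      · simpa [hy] using sq_nonneg (x.1.2 : ℝ)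
      · simpa [hy] using sq_nonneg (x.1.1 : ℝ)
    have h2 : (x.1.1 : ℝ) ^ 2 + (x.1.2 : ℝ) ^ 2 ≤ (x.1.1 : ℝ) ^ 2 + d * (x.1.2 : ℝ) ^ 2 := by
      nlinarith [sq_nonneg (x.1.2 : ℝ)]
    have h3 : (1 : ℝ) ≤ 2 * Real.pi := by linarith [Real.pi_gt_three]
    exact h1.trans (h2.trans (le_mul_of_one_le_left ((sq_nonneg _).trans h1 |>.trans h2) h3))
  refine (Real.rpow_le_rpow_of_nonpos (by positivity) hle (by linarith)).trans_eq ?_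
  rw [← Real.rpow_two, ← Real.rpow_mul hy0.le]
  ring_nf

/-- The theta series factors into two one-dimensional Gaussian sums. The bound `d ≤ 2` enters only
in `large`. -/
theorem isThetaSeq_form {d : ℝ} (hd : 1 ≤ d) (hd2 : d ≤ 2) :
    IsThetaSeq (fun x : {x : ℤ × ℤ // x ≠ 0} =>
      2 * Real.pi * ((x.1.1 : ℝ) ^ 2 + d * (x.1.2 : ℝ) ^ 2)) 1 (1 / (4 * d)) (2 * √d) where
  pos := form_pos (by linarith)
  r_pos := one_pos
  r_le_one := le_rfl
  C_pos := by positivity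
  A_pos := by positivity
  summable _ hσ := summable_form_rpow hd hσ
  theta_reflection t ht := by
    have hd0 : 0 < d := by linarith
    have key : ∀ t, 0 < t → 1 + expSeries (fun x : {x : ℤ × ℤ // x ≠ 0} =>
        2 * Real.pi * ((x.1.1 : ℝ) ^ 2 + d * (x.1.2 : ℝ) ^ 2)) 0 t =
        gaussSum (2 * t) * gaussSum (2 * d * t) := by
      intro t ht
      have hZ : ∀ t, 0 < t → Summable fun n : ℤ => Real.exp (-(Real.pi * (n : ℝ) ^ 2 * t)) :=
        fun t ht => (one_add_expSeries_zero (q := fun n : ℤ => Real.pi * (n : ℝ) ^ 2) (a := 0)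
          (by simp) (summable_int_exp ht)).1
      have s1 := hZ (2 * t) (by positivity)
      have s2 := hZ (2 * d * t) (by positivity)
      have e : ∀ x : ℤ × ℤ,
          Real.exp (-(2 * Real.pi * ((x.1 : ℝ) ^ 2 + d * (x.2 : ℝ) ^ 2) * t)) =
          Real.exp (-(Real.pi * (x.1 : ℝ) ^ 2 * (2 * t))) *
            Real.exp (-(Real.pi * (x.2 : ℝ) ^ 2 * (2 * d * t))) := fun x => by
        rw [← Real.exp_add]; congr 1; ring
      have s3 := s1.mul_of_nonneg s2 (fun _ => (Real.exp_pos _).le) (fun _ => (Real.exp_pos _).le)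
      have s4 : Summable fun x : ℤ × ℤ =>
          Real.exp (-(2 * Real.pi * ((x.1 : ℝ) ^ 2 + d * (x.2 : ℝ) ^ 2) * t)) :=
        s3.congr fun x => (e x).symm
      rw [(one_add_expSeries_zero
        (q := fun x : ℤ × ℤ => 2 * Real.pi * ((x.1 : ℝ) ^ 2 + d * (x.2 : ℝ) ^ 2)) (a := 0)
        (by simp) (s4.comp_injective Subtype.val_injective)).2, tsum_congr e, gaussSum, gaussSum,
        s1.tsum_mul_tsum s2 s3]
    -- Under `t ↦ 1/(4dt)` the arguments `2t` and `2dt` are inverted and exchanged.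
    rw [key _ ht, key _ (by positivity),
      show 2 * (1 / (4 * d) / t) = 1 / (2 * d * t) by field_simp; norm_num,
      show 2 * d * (1 / (4 * d) / t) = 1 / (2 * t) by field_simp; norm_num,
      gaussSum_inv (by positivity), gaussSum_inv (by positivity), Real.rpow_one]
    have : √(2 * d * t) * √(2 * t) = 2 * √d * t := by
      rw [← Real.sqrt_mul (by positivity),
        show 2 * d * t * (2 * t) = (2 * t) ^ 2 * d by ring, Real.sqrt_mul (by positivity),
        Real.sqrt_sq (by positivity)]
      ring
    linear_combination (gaussSum (2 * t) * gaussSum (2 * d * t)) * this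
  large x := by
    have hd0 : 0 < d := by linarith
    have h1 := one_le_form hd x
    -- The requirement is `π (x² + d y²) / √d ≥ 2`; with `x² + d y² ≥ 1` and `π > 3` it suffices
    -- that `√d ≤ 3/2`.
    have h2 : √d ≤ 3 / 2 := by
      rw [Real.sqrt_le_left (by norm_num)]; norm_num; linarith
    have h3 : √(1 / (4 * d)) = 1 / (2 * √d) := by
      rw [Real.sqrt_div zero_le_one, Real.sqrt_one, Real.sqrt_mul (by norm_num),
        show (4 : ℝ) = 2 ^ 2 by norm_num, Real.sqrt_sq (by norm_num)]
    have h4 : 0 < √d := Real.sqrt_pos.mpr hd0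
    rw [h3, mul_one_div, le_div_iff₀ (by positivity)]
    have := Real.pi_gt_three
    nlinarith

/-! ### Zeta as a sum over elements: class number one, finite unit group -/

section PrincipalIdeals

variable (K : Type*) [Field K] [NumberField K]

theorem mem_torsion_of_rank_eq_zero (h : Units.rank K = 0) (u : (𝓞 K)ˣ) :
    u ∈ Units.torsion K := by
  obtain ⟨⟨ζ, e⟩, he, -⟩ := Units.exist_unique_eq_mul_prod K u
  have : IsEmpty (Fin (Units.rank K)) := by rw [h]; infer_instance
  rw [he, Finset.univ_eq_empty, Finset.prod_empty, mul_one]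
  exact ζ.2

theorem regulator_eq_one_of_rank_eq_zero (h : Units.rank K = 0) : Units.regulator K = 1 := by
  classical
  have : IsEmpty (Fin (Units.rank K)) := by rw [h]; infer_instance
  have := (Units.equivFinRank K).symm.isEmpty
  rw [Units.regulator_eq_det', Matrix.det_isEmpty, abs_one]

/-- A nonzero element is uniquely a root of unity times the chosen generator of its ideal. Norm `0`
is separate: the zero ideal has it, no nonzero element does. -/
theorem card_norm_fiber [IsPrincipalIdealRing (𝓞 K)] (h : Units.rank K = 0) (n : ℕ) :
    Nat.card ((fun a : {a : 𝓞 K // a ≠ 0} => (Algebra.norm ℤ a.1).natAbs) ⁻¹' {n}) =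
      if n = 0 then 0 else
        Units.torsionOrder K * Nat.card {I : Ideal (𝓞 K) // Ideal.absNorm I = n} := by
  split_ifs with hn
  · have : IsEmpty ((fun a : {a : 𝓞 K // a ≠ 0} => (Algebra.norm ℤ a.1).natAbs) ⁻¹' {n}) := by
      refine ⟨fun ⟨a, ha⟩ => a.2 ?_⟩
      rw [hn] at ha
      simpa [Algebra.norm_eq_zero_iff] using ha
    exact Nat.card_of_isEmpty
  · rw [Units.torsionOrder, ← Nat.card_prod]
    symm
    have gen : ∀ I : Ideal (𝓞 K), Ideal.span {Submodule.IsPrincipal.generator I} = I :=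
      fun I => Ideal.span_singleton_generator I
    have genNorm : ∀ I : Ideal (𝓞 K),
        (Algebra.norm ℤ (Submodule.IsPrincipal.generator I)).natAbs = Ideal.absNorm I := by
      intro I
      rw [← Ideal.absNorm_span_singleton, gen]
    have gen0 : ∀ I : {I : Ideal (𝓞 K) // Ideal.absNorm I = n},
        Submodule.IsPrincipal.generator I.1 ≠ 0 := by
      intro I h0
      have := genNorm I.1
      rw [h0, I.2] at this
      simp at this
      exact hn this.symm
    have normUnit : ∀ u : (𝓞 K)ˣ, (Algebra.norm ℤ (u : 𝓞 K)).natAbs = 1 := fun u =>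
      Int.isUnit_iff_natAbs_eq.mp (u.isUnit.map (Algebra.norm ℤ))
    let f : Units.torsion K × {I : Ideal (𝓞 K) // Ideal.absNorm I = n} →
        ((fun a : {a : 𝓞 K // a ≠ 0} => (Algebra.norm ℤ a.1).natAbs) ⁻¹' {n}) := fun x =>
      ⟨⟨(x.1.1 : 𝓞 K) * Submodule.IsPrincipal.generator x.2.1,
        mul_ne_zero x.1.1.ne_zero (gen0 x.2)⟩, by
        rw [mem_preimage, mem_singleton_iff, map_mul, Int.natAbs_mul, normUnit, one_mul, genNorm,
          x.2.2]⟩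
    refine Nat.card_congr (Equiv.ofBijective f ⟨?_, ?_⟩)
    · rintro ⟨ζ, I⟩ ⟨ζ', I'⟩ hf
      have h1 : (ζ.1 : 𝓞 K) * Submodule.IsPrincipal.generator I.1 =
          (ζ'.1 : 𝓞 K) * Submodule.IsPrincipal.generator I'.1 :=
        congrArg (fun x => x.1.1) hf
      have h2 : I = I' := by
        apply Subtype.ext
        rw [← gen I.1, ← gen I'.1, ← Ideal.span_singleton_mul_left_unit ζ.1.isUnit, h1,
          Ideal.span_singleton_mul_left_unit ζ'.1.isUnit]
      subst h2
      have h3 := mul_right_cancel₀ (gen0 I) h1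
      exact Prod.ext (Subtype.ext (Units.ext h3)) rfl
    · rintro ⟨⟨a, ha0⟩, ha⟩
      have ha : (Algebra.norm ℤ a).natAbs = n := ha
      have h1 : Associated (Submodule.IsPrincipal.generator (Ideal.span {a})) a :=
        Ideal.span_singleton_eq_span_singleton.mp (gen _)
      obtain ⟨u, hu⟩ := h1
      refine ⟨⟨⟨u, mem_torsion_of_rank_eq_zero K h u⟩, ⟨Ideal.span {a}, ?_⟩⟩, ?_⟩
      · rw [Ideal.absNorm_span_singleton, ha]
      · refine Subtype.ext (Subtype.ext ?_)
        simp only [f]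
        rw [mul_comm, hu]

theorem torsionOrder_mul_dedekindZeta [IsPrincipalIdealRing (𝓞 K)] (h : Units.rank K = 0) {s : ℂ}
    (hs : Summable fun a : {a : 𝓞 K // a ≠ 0} => ((Algebra.norm ℤ a.1).natAbs : ℂ) ^ (-s)) :
    Units.torsionOrder K * dedekindZeta K s =
      ∑' a : {a : 𝓞 K // a ≠ 0}, ((Algebra.norm ℤ a.1).natAbs : ℂ) ^ (-s) := by
  set N : {a : 𝓞 K // a ≠ 0} → ℕ := fun a => (Algebra.norm ℤ a.1).natAbs with hN
  have h1 : Summable fun c : (n : ℕ) × {a // N a = n} =>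
      ((Algebra.norm ℤ ((Equiv.sigmaFiberEquiv N) c).1).natAbs : ℂ) ^ (-s) :=
    (Equiv.sigmaFiberEquiv N).summable_iff.mpr hs
  rw [← (Equiv.sigmaFiberEquiv N).tsum_eq, Summable.tsum_sigma h1, dedekindZeta, LSeries,
    ← tsum_mul_left]
  refine tsum_congr fun n => ?_
  have h2 : ∀ a : {a // N a = n},
      ((Algebra.norm ℤ ((Equiv.sigmaFiberEquiv N) ⟨n, a⟩).1).natAbs : ℂ) ^ (-s) =
        (n : ℂ) ^ (-s) := by
    rintro ⟨a, ha⟩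
    have : (Algebra.norm ℤ ((Equiv.sigmaFiberEquiv N) ⟨n, ⟨a, ha⟩⟩).1).natAbs = n := ha
    rw [this]
  rw [tsum_congr h2, tsum_const, nsmul_eq_mul]
  have h3 : Nat.card {a // N a = n} = _ := card_norm_fiber K h n
  rw [h3]
  split_ifs with hn
  · rw [hn, LSeries.term_zero, mul_zero, Nat.cast_zero, zero_mul]
  · rw [LSeries.term_of_ne_zero hn, Complex.cpow_neg]
    push_cast
    ring

/-- With `h = R = 1`, the `w` in `c_K⁻¹` turns zeta into the sum over elements, and
`2^{r₁}(2π)^{r₂}` is distributed over the Gamma factors. -/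
theorem residueConst_inv_mul_completedZeta [IsPrincipalIdealRing (𝓞 K)] (h : Units.rank K = 0)
    {s : ℂ}
    (hs : Summable fun a : {a : 𝓞 K // a ≠ 0} => ((Algebra.norm ℤ a.1).natAbs : ℂ) ^ (-s)) :
    (residueConst K : ℂ)⁻¹ * completedZeta K s =
      (Complex.Gammaℝ s / 2) ^ InfinitePlace.nrRealPlaces K *
        ((2 * Real.pi : ℂ) ^ (-s) * Complex.Gamma s) ^ InfinitePlace.nrComplexPlaces K *
        ∑' a : {a : 𝓞 K // a ≠ 0}, ((Algebra.norm ℤ a.1).natAbs : ℂ) ^ (-s) := by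
  have hπ : (2 * Real.pi : ℂ) ≠ 0 := by
    exact_mod_cast (mul_pos two_pos Real.pi_pos).ne'
  have hw : (Units.torsionOrder K : ℂ) ≠ 0 := by
    exact_mod_cast (Units.torsionOrder_pos K).ne'
  have hc : classNumber K = 1 := classNumber_eq_one_iff.mpr inferInstance
  rw [← torsionOrder_mul_dedekindZeta K h hs, residueConst, completedZeta, gammaC,
    regulator_eq_one_of_rank_eq_zero K h, hc, sub_eq_add_neg, Complex.cpow_add _ _ hπ,
    Complex.cpow_one]
  push_cast
  rw [mul_assoc (2 * (Real.pi : ℂ)), mul_pow (2 * (Real.pi : ℂ)) (_ * _), div_pow]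
  field_simp

end PrincipalIdeals

/-! ### Norm, trace and discriminant in a basis `1, √-d` -/

section QuadraticBasis

variable {R S : Type*} [CommRing R] [CommRing S] [Algebra R S]

theorem leftMulMatrix_quadratic (b : Module.Basis (Fin 2) R S) {d : R} (h0 : b 0 = 1)
    (h1 : b 1 * b 1 = algebraMap R S (-d)) (m n : R) :
    Algebra.leftMulMatrix b (m • b 0 + n • b 1) = !![m, -(d * n); n, m] := by
  have e0 : (m • b 0 + n • b 1) * b 0 = m • b 0 + n • b 1 := by rw [h0, mul_one]
  have e1 : (m • b 0 + n • b 1) * b 1 = (-(d * n)) • b 0 + m • b 1 := by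
    rw [add_mul, smul_mul_assoc, smul_mul_assoc, h1, h0, one_mul, Algebra.algebraMap_eq_smul_one,
      smul_smul, add_comm]
    congr 2
    ring
  ext i j
  rw [Algebra.leftMulMatrix_eq_repr_mul]
  fin_cases j
  · simp only [Fin.zero_eta, e0]
    fin_cases i <;> simp
  · simp only [Fin.mk_one, e1]
    fin_cases i <;> simp

theorem norm_quadratic (b : Module.Basis (Fin 2) R S) {d : R} (h0 : b 0 = 1)
    (h1 : b 1 * b 1 = algebraMap R S (-d)) (m n : R) :
    Algebra.norm R (m • b 0 + n • b 1) = m ^ 2 + d * n ^ 2 := by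
  rw [Algebra.norm_eq_matrix_det b, leftMulMatrix_quadratic b h0 h1, Matrix.det_fin_two_of]
  ring

theorem trace_quadratic (b : Module.Basis (Fin 2) R S) {d : R} (h0 : b 0 = 1)
    (h1 : b 1 * b 1 = algebraMap R S (-d)) (m n : R) :
    Algebra.trace R S (m • b 0 + n • b 1) = 2 * m := by
  rw [Algebra.trace_eq_matrix_trace b, leftMulMatrix_quadratic b h0 h1, Matrix.trace_fin_two_of]
  ring

theorem discr_quadratic (b : Module.Basis (Fin 2) R S) {d : R} (h0 : b 0 = 1)
    (h1 : b 1 * b 1 = algebraMap R S (-d)) : Algebra.discr R b = -(4 * d) := by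
  have t0 : Algebra.trace R S 1 = 2 := by
    simpa [h0] using trace_quadratic b h0 h1 1 0
  have t1 : Algebra.trace R S (b 1) = 0 := by
    simpa using trace_quadratic b h0 h1 0 1
  have t2 : Algebra.trace R S (b 1 * b 1) = -(2 * d) := by
    have := trace_quadratic b h0 h1 (-d) 0
    rw [h1, Algebra.algebraMap_eq_smul_one]
    rw [h0, zero_smul, add_zero] at this
    rw [this]; ring
  rw [Algebra.discr_def, Matrix.det_fin_two]
  simp only [Algebra.traceMatrix_apply, Algebra.traceForm_apply, h0, one_mul, mul_one, t0, t1, t2]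
  ring

end QuadraticBasis

/-- This is why the ring of integers is `ℤ[√-d]`. The number `n = 2db` is rational with integral
square, hence an integer, and parity in `d m² + n² = 4dk` makes `m` and `n` divisible by `2` and
`2d`. -/
theorem exists_int_of_trace_norm {d : ℤ} (hd : d = 1 ∨ d = 2) {a b : ℚ} {m k : ℤ}
    (hm : 2 * a = m) (hk : a ^ 2 + d * b ^ 2 = k) : ∃ x y : ℤ, a = x ∧ b = y := by
  obtain ⟨n, hn⟩ : ∃ n : ℤ, (n : ℚ) = 2 * d * b := by
    have h : (2 * d * b) ^ 2 = ((d * (4 * k - m ^ 2) : ℤ) : ℚ) := by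
      push_cast
      rw [← hm, ← hk]
      ring
    have h2 : IsIntegral ℤ ((2 * d * b) ^ 2) := by
      rw [h]; exact isIntegral_algebraMap (x := (d * (4 * k - m ^ 2) : ℤ))
    obtain ⟨n, hn⟩ := IsIntegrallyClosed.isIntegral_iff.mp (h2.of_pow two_pos)
    exact ⟨n, by simpa using hn⟩
  have h1 : d * m ^ 2 + n ^ 2 = 4 * d * k := by
    have : (d : ℚ) * m ^ 2 + n ^ 2 = 4 * d * k := by rw [hn, ← hm, ← hk]; ring
    exact_mod_cast this
  rcases hd with rfl | rfl
  · have hm2 : Even m := by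
      by_contra h
      rw [Int.not_even_iff_odd] at h
      obtain ⟨u, rfl⟩ := h
      rcases Int.even_or_odd' n with ⟨v, rfl | rfl⟩
      · ring_nf at h1; omega
      · ring_nf at h1; omega
    obtain ⟨u, rfl⟩ := hm2
    have hn2 : Even n := by
      have h2 : Even (n ^ 2) := ⟨2 * (k - u ^ 2), by linarith⟩
      exact (Int.even_pow' two_ne_zero).mp h2
    obtain ⟨v, rfl⟩ := hn2
    refine ⟨u, v, ?_, ?_⟩
    · push_cast at hm; linarith
    · push_cast at hn; linarith
  · have hn2 : Even n := by
      have h2 : Even (n ^ 2) := ⟨4 * k - m ^ 2, by linarith⟩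
      exact (Int.even_pow' two_ne_zero).mp h2
    obtain ⟨v, rfl⟩ := hn2
    have hm2 : Even m := by
      have h2 : Even (m ^ 2) := ⟨2 * k - v ^ 2, by linarith⟩
      exact (Int.even_pow' two_ne_zero).mp h2
    obtain ⟨u, rfl⟩ := hm2
    have hv2 : Even v := by
      have h2 : Even (v ^ 2) := ⟨k - u ^ 2, by linarith⟩
      exact (Int.even_pow' two_ne_zero).mp h2
    obtain ⟨w, rfl⟩ := hv2
    refine ⟨u, w, ?_, ?_⟩
    · push_cast at hm; linarith
    · push_cast at hn; linarith

/-! ### The fields `ℚ(√-1)` and `ℚ(√-2)` -/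

section Quadratic

variable {K : Type*} [Field K] [NumberField K] {d : ℤ} {α : K}

theorem sq_add_mul_sq_ne_zero (hd : 0 < d) (q : ℚ) : q ^ 2 ≠ -(d : ℚ) := by
  have : (0 : ℚ) < d := by exact_mod_cast hd
  nlinarith [sq_nonneg q]

theorem linearIndependent_one_sqrt (hd : 0 < d) (hα : α ^ 2 = -d) :
    LinearIndependent ℚ ![1, α] := by
  rw [LinearIndependent.pair_iff]
  intro s t h
  have ht : t = 0 := by
    by_contra ht
    have h1 : α = ((-s / t : ℚ) : K) := by
      have ht' : (t : K) ≠ 0 := by exact_mod_cast ht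
      push_cast
      rw [eq_div_iff ht']
      simp only [Rat.smul_def, mul_one] at h
      linear_combination h
    rw [h1] at hα
    exact sq_add_mul_sq_ne_zero hd _ (by exact_mod_cast hα)
  subst ht
  simpa using h

theorem exists_eq_add_mul_sqrt (hα : α ^ 2 = -d) (ht : IntermediateField.adjoin ℚ {α} = ⊤)
    (x : K) : ∃ a b : ℚ, x = a + b * α := by
  have hint : IsAlgebraic ℚ α := Algebra.IsAlgebraic.isAlgebraic α
  have hx : x ∈ Algebra.adjoin ℚ {α} := by
    rw [← IntermediateField.adjoin_simple_toSubalgebra_of_isAlgebraic hint, ht]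
    trivial
  induction hx using Algebra.adjoin_induction with
  | mem x hx => exact ⟨0, 1, by simpa using hx⟩
  | algebraMap r => exact ⟨r, 0, by simp⟩
  | add x y _ _ hx hy =>
    obtain ⟨a, b, rfl⟩ := hx
    obtain ⟨a', b', rfl⟩ := hy
    exact ⟨a + a', b + b', by push_cast; ring⟩
  | mul x y _ _ hx hy =>
    obtain ⟨a, b, rfl⟩ := hx
    obtain ⟨a', b', rfl⟩ := hy
    refine ⟨a * a' - d * b * b', a * b' + a' * b, ?_⟩
    push_cast
    linear_combination (b * b' : K) * hα

theorem exists_basis_rat (hd : 0 < d) (hα : α ^ 2 = -d)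
    (ht : IntermediateField.adjoin ℚ {α} = ⊤) :
    ∃ b : Module.Basis (Fin 2) ℚ K, b 0 = 1 ∧ b 1 = α := by
  refine ⟨Module.Basis.mk (linearIndependent_one_sqrt hd hα) fun x _ => ?_, by simp, by simp⟩
  obtain ⟨a, b, rfl⟩ := exists_eq_add_mul_sqrt hα ht x
  rw [Matrix.range_cons, Matrix.range_cons, Matrix.range_empty, union_empty, singleton_union,
    Submodule.mem_span_pair]
  exact ⟨a, b, by simp [Rat.smul_def]⟩

theorem exists_basis_int (hd : d = 1 ∨ d = 2) (hα : α ^ 2 = -d)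
    (ht : IntermediateField.adjoin ℚ {α} = ⊤) :
    ∃ b : Module.Basis (Fin 2) ℤ (𝓞 K), b 0 = 1 ∧ b 1 * b 1 = algebraMap ℤ (𝓞 K) (-d) := by
  have hd0 : 0 < d := by omega
  have hint : IsIntegral ℤ α := by
    refine IsIntegral.of_pow two_pos ?_
    rw [hα]
    have := isIntegral_algebraMap (R := ℤ) (A := K) (x := -d)
    simpa using this
  obtain ⟨θ, hθ⟩ : ∃ θ : 𝓞 K, algebraMap (𝓞 K) K θ = α := ⟨⟨α, hint⟩, rfl⟩
  have hli : LinearIndependent ℤ ![1, θ] := by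
    rw [LinearIndependent.pair_iff]
    intro s t h
    have h2 := congrArg (algebraMap (𝓞 K) K) h
    rw [map_add, map_zsmul, map_zsmul, map_one, map_zero, hθ] at h2
    have h3 : (s : ℚ) • (1 : K) + (t : ℚ) • α = 0 := by
      rw [Rat.smul_def, Rat.smul_def, Rat.cast_intCast, Rat.cast_intCast, ← zsmul_eq_mul,
        ← zsmul_eq_mul, h2]
    have h1 := LinearIndependent.pair_iff.mp (linearIndependent_one_sqrt (K := K) hd0 hα)
      (s : ℚ) (t : ℚ) h3
    exact ⟨by exact_mod_cast h1.1, by exact_mod_cast h1.2⟩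
  refine ⟨Module.Basis.mk hli fun x _ => ?_, by simp, ?_⟩
  · obtain ⟨B, B0, B1⟩ := exists_basis_rat hd0 hα ht
    obtain ⟨a, b, hx⟩ := exists_eq_add_mul_sqrt hα ht (algebraMap (𝓞 K) K x)
    have hx' : algebraMap (𝓞 K) K x = a • B 0 + b • B 1 := by
      rw [hx, B0, B1]; simp [Rat.smul_def]
    have hB : B 1 * B 1 = algebraMap ℚ K (-(d : ℚ)) := by
      rw [B1, ← sq, hα]; simp
    have htr := Algebra.isIntegral_trace (R := ℤ) (L := ℚ) x.isIntegral_coe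
    have hno := Algebra.isIntegral_norm (R := ℤ) ℚ x.isIntegral_coe
    rw [hx', trace_quadratic B B0 hB] at htr
    rw [hx', norm_quadratic B B0 hB] at hno
    obtain ⟨m, hm⟩ := IsIntegrallyClosed.isIntegral_iff.mp htr
    obtain ⟨k, hk⟩ := IsIntegrallyClosed.isIntegral_iff.mp hno
    obtain ⟨u, v, rfl, rfl⟩ := exists_int_of_trace_norm hd hm.symm hk.symm
    rw [Matrix.range_cons, Matrix.range_cons, Matrix.range_empty, union_empty, singleton_union,
      Submodule.mem_span_pair]
    refine ⟨u, v, ?_⟩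
    apply FaithfulSMul.algebraMap_injective (𝓞 K) K
    rw [hx]
    simp [hθ]
  · apply FaithfulSMul.algebraMap_injective (𝓞 K) K
    simp only [Module.Basis.mk_apply, Matrix.cons_val_one, Matrix.cons_val_fin_one, map_mul, hθ]
    rw [← sq, hα]
    simp

theorem nrRealPlaces_eq_zero_of_sq_neg (hd : 0 < d) (hα : α ^ 2 = -d) :
    InfinitePlace.nrRealPlaces K = 0 := by
  refine nrRealPlaces_eq_zero_iff.mpr ⟨fun w =>
    InfinitePlace.not_isReal_iff_isComplex.mp fun hw => ?_⟩
  have h := congrArg (InfinitePlace.embedding_of_isReal hw) hα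
  rw [map_pow, map_neg, map_intCast] at h
  have hd' : (0 : ℝ) < d := by exact_mod_cast hd
  nlinarith [sq_nonneg (InfinitePlace.embedding_of_isReal hw α)]

theorem nrComplexPlaces_eq_one_of_sq_neg (hd : 0 < d) (hα : α ^ 2 = -d)
    (ht : IntermediateField.adjoin ℚ {α} = ⊤) : InfinitePlace.nrComplexPlaces K = 1 := by
  obtain ⟨B, -, -⟩ := exists_basis_rat hd hα ht
  have h1 := InfinitePlace.card_add_two_mul_card_eq_rank K
  rw [nrRealPlaces_eq_zero_of_sq_neg hd hα, Module.finrank_eq_card_basis B, Fintype.card_fin] at h1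
  omega

theorem isPrincipalIdealRing_of_sq_neg (hd : d = 1 ∨ d = 2) (hα : α ^ 2 = -d)
    (ht : IntermediateField.adjoin ℚ {α} = ⊤) : IsPrincipalIdealRing (𝓞 K) := by
  have hd0 : 0 < d := by omega
  obtain ⟨B, -, -⟩ := exists_basis_rat hd0 hα ht
  obtain ⟨b, b0, b1⟩ := exists_basis_int hd hα ht
  apply RingOfIntegers.isPrincipalIdealRing_of_abs_discr_lt
  rw [nrComplexPlaces_eq_one_of_sq_neg hd0 hα ht, Module.finrank_eq_card_basis B, Fintype.card_fin,
    ← discr_eq_discr K b, discr_quadratic b b0 b1]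
  -- The Minkowski criterion for degree `2` with one complex place reads `|D| < π²`, and `8 < 9 <
  -- π²`.
  have h1 : |-(4 * d)| ≤ 8 := by
    rcases hd with rfl | rfl <;> decide
  have h2 : ((|-(4 * d)| : ℤ) : ℝ) ≤ 8 := by exact_mod_cast h1
  have := Real.pi_gt_three
  norm_num [Nat.factorial] at h2 ⊢
  nlinarith

end Quadratic

/-! ### Matching the fields with their theta sequences -/

variable {K : Type*} [Field K] [NumberField K]

/-- The conclusion for a number field with class number one and finite unit group whose norms
are, up to a common scaling, powers of the members of a theta sequence. -/
theorem IsThetaSeq.exists_random_variable_of_norm {ι : Type*} [Countable ι] [Nonempty ι]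
    {p : ι → ℝ} {r C A : ℝ} (H : IsThetaSeq p r C A) [IsPrincipalIdealRing (𝓞 K)]
    (hrank : Units.rank K = 0) (ε : {a : 𝓞 K // a ≠ 0} ≃ ι) (c : ℂ → ℂ) (hc : ∀ s, c s ≠ 0)
    (hterm : ∀ (s : ℂ) a, (p (ε a) : ℂ) ^ (-(r * s)) =
      c s * ((Algebra.norm ℤ a.1).natAbs : ℂ) ^ (-s))
    (hgamma : ∀ s : ℂ, (Complex.Gammaℝ s / 2) ^ InfinitePlace.nrRealPlaces K *
        ((2 * Real.pi : ℂ) ^ (-s) * Complex.Gamma s) ^ InfinitePlace.nrComplexPlaces K =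
        r * Complex.Gamma (r * s) * c s) :
    IsXi K (xi K) ∧
    ∃ (Ω : Type) (_ : MeasurableSpace Ω) (P : Measure Ω) (X : Ω → ℝ),
      IsProbabilityMeasure P ∧ Measurable X ∧ (∀ ω, 0 < X ω) ∧
      (P.map X).AbsolutelyContinuous volume ∧
      ∀ s : ℂ, Integrable (fun ω => (X ω : ℂ) ^ s) P ∧
        ∫ ω, (X ω : ℂ) ^ s ∂P = ((|NumberField.discr K| : ℤ) : ℂ) ^ (-s / 2) * xi K s := by
  refine H.exists_random_variable K fun s hs => ?_
  have h1 : Summable fun i => (p i : ℂ) ^ (-(r * s)) := by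
    refine Summable.of_norm ((H.summable (r * s.re) (lt_mul_of_one_lt_right H.r_pos hs)).congr
      fun i => ?_)
    rw [Complex.norm_cpow_eq_rpow_re_of_pos (H.pos i)]
    simp
  have h2 : Summable fun a : {a : 𝓞 K // a ≠ 0} =>
      ((Algebra.norm ℤ a.1).natAbs : ℂ) ^ (-s) := by
    have h3 : Summable fun a => (p (ε a) : ℂ) ^ (-(r * s)) := ε.summable_iff.mpr h1
    simp_rw [hterm] at h3
    exact (summable_mul_left_iff (hc s)).mp h3
  rw [residueConst_inv_mul_completedZeta K hrank h2, hgamma,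
    ← ε.tsum_eq (fun i => (p i : ℂ) ^ (-(r * s))), tsum_congr (hterm s), tsum_mul_left]
  ring

/-- The nonzero elements of two additive groups correspond under an additive equivalence. -/
def nonzeroEquiv {M N : Type*} [AddGroup M] [AddGroup N] (e : M ≃+ N) :
    {x : M // x ≠ 0} ≃ {y : N // y ≠ 0} :=
  e.toEquiv.subtypeEquiv fun x => by simp

theorem exists_random_variable_of_equiv_rat (e : K ≃+* ℚ) :
    IsXi K (xi K) ∧
    ∃ (Ω : Type) (_ : MeasurableSpace Ω) (P : Measure Ω) (X : Ω → ℝ),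
      IsProbabilityMeasure P ∧ Measurable X ∧ (∀ ω, 0 < X ω) ∧
      (P.map X).AbsolutelyContinuous volume ∧
      ∀ s : ℂ, Integrable (fun ω => (X ω : ℂ) ^ s) P ∧
        ∫ ω, (X ω : ℂ) ^ s ∂P = ((|NumberField.discr K| : ℤ) : ℂ) ^ (-s / 2) * xi K s := by
  have : Nonempty {n : ℤ // n ≠ 0} := ⟨⟨1, one_ne_zero⟩⟩
  let E : 𝓞 K ≃+* ℤ := (RingOfIntegers.mapRingEquiv e).trans Rat.ringOfIntegersEquiv
  have hpid : IsPrincipalIdealRing (𝓞 K) :=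
    IsPrincipalIdealRing.of_surjective E.symm.toRingHom E.symm.surjective
  have hfin : Module.finrank ℚ K = 1 := by
    let e' : K ≃ₐ[ℚ] ℚ := AlgEquiv.ofRingEquiv (f := e) fun _ => by simp
    rw [e'.toLinearEquiv.finrank_eq, Module.finrank_self]
  have hr1 := InfinitePlace.nrRealPlaces_eq_one_of_finrank_eq_one hfin
  have hr2 := InfinitePlace.nrComplexPlaces_eq_zero_of_finrank_eq_one hfin
  have hrank : Units.rank K = 0 := by
    rw [Units.rank, InfinitePlace.card_eq_nrRealPlaces_add_nrComplexPlaces, hr1, hr2]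
  have hnorm : ∀ a : 𝓞 K, Algebra.norm ℤ a = E a := by
    intro a
    let E' : 𝓞 K ≃ₐ[ℤ] ℤ := AlgEquiv.ofRingEquiv (f := E) fun _ => by simp
    rw [← Algebra.norm_eq_of_algEquiv E' a, Algebra.norm_self]
    rfl
  have hπ : (Real.pi : ℂ) ≠ 0 := by exact_mod_cast Real.pi_ne_zero
  -- The scaling `c` comes from `(π n²)^(-s/2) = π^(-s/2) |n|^(-s)`.
  refine isThetaSeq_int.exists_random_variable_of_norm hrank (nonzeroEquiv E.toAddEquiv)
    (fun s => (Real.pi : ℂ) ^ (-s / 2)) (fun s => by simp [Complex.cpow_eq_zero_iff, hπ])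
    (fun s a => ?_) (fun s => ?_)
  · set n := nonzeroEquiv E.toAddEquiv a with hn
    have hN : Algebra.norm ℤ a.1 = n.1 := hnorm a.1
    rw [hN]
    have hn0 : (0 : ℝ) < (n.1.natAbs : ℝ) := by
      exact_mod_cast Int.natAbs_pos.mpr n.2
    have e : (n : ℝ) ^ 2 = (n.1.natAbs : ℝ) ^ 2 := by
      rw [Nat.cast_natAbs, Int.cast_abs, sq_abs]
    rw [e, ofReal_cpow_eq_exp (mul_pos Real.pi_pos (by positivity)),
      Real.log_mul Real.pi_pos.ne' (by positivity), Real.log_pow,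
      ofReal_cpow_eq_exp Real.pi_pos, ← Complex.ofReal_natCast n.1.natAbs, ofReal_cpow_eq_exp hn0,
      ← Complex.exp_add]
    congr 1
    push_cast
    ring
  · rw [hr1, hr2, pow_one, pow_zero, mul_one, Complex.Gammaℝ_def,
      show ((1 / 2 : ℝ) : ℂ) * s = s / 2 by push_cast; ring]
    push_cast
    ring

theorem exists_random_variable_of_sq_neg {d : ℤ} (hd : d = 1 ∨ d = 2) {α : K} (hα : α ^ 2 = -d)
    (ht : IntermediateField.adjoin ℚ {α} = ⊤) :
    IsXi K (xi K) ∧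
    ∃ (Ω : Type) (_ : MeasurableSpace Ω) (P : Measure Ω) (X : Ω → ℝ),
      IsProbabilityMeasure P ∧ Measurable X ∧ (∀ ω, 0 < X ω) ∧
      (P.map X).AbsolutelyContinuous volume ∧
      ∀ s : ℂ, Integrable (fun ω => (X ω : ℂ) ^ s) P ∧
        ∫ ω, (X ω : ℂ) ^ s ∂P = ((|NumberField.discr K| : ℤ) : ℂ) ^ (-s / 2) * xi K s := by
  have : Nonempty {x : ℤ × ℤ // x ≠ 0} := ⟨⟨1, one_ne_zero⟩⟩
  have hd0 : 0 < d := by omega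
  have hpid := isPrincipalIdealRing_of_sq_neg hd hα ht
  obtain ⟨b, b0, b1⟩ := exists_basis_int hd hα ht
  have hr1 := nrRealPlaces_eq_zero_of_sq_neg hd0 hα
  have hr2 := nrComplexPlaces_eq_one_of_sq_neg hd0 hα ht
  have hrank : Units.rank K = 0 := by
    rw [Units.rank, InfinitePlace.card_eq_nrRealPlaces_add_nrComplexPlaces, hr1, hr2]
  let E : 𝓞 K ≃+ ℤ × ℤ :=
    (b.equivFun.trans (LinearEquiv.finTwoArrow ℤ ℤ)).toAddEquiv
  have hnorm : ∀ a : 𝓞 K, Algebra.norm ℤ a = (E a).1 ^ 2 + d * (E a).2 ^ 2 := by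
    intro a
    conv_lhs => rw [← b.sum_equivFun a, Fin.sum_univ_two]
    exact norm_quadratic b b0 b1 _ _
  have hd1 : (1 : ℝ) ≤ d := by exact_mod_cast (by omega : 1 ≤ d)
  have hd2 : (d : ℝ) ≤ 2 := by exact_mod_cast (by omega : d ≤ 2)
  have hπ : (2 * Real.pi : ℂ) ≠ 0 := by exact_mod_cast (mul_pos two_pos Real.pi_pos).ne'
  refine (isThetaSeq_form hd1 hd2).exists_random_variable_of_norm hrank (nonzeroEquiv E)
    (fun s => (2 * Real.pi : ℂ) ^ (-s)) (fun s => by 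
      simp only [ne_eq, Complex.cpow_eq_zero_iff, hπ, false_and, not_false_eq_true])
    (fun s a => ?_) (fun s => ?_)
  · have hN : ((Algebra.norm ℤ a.1).natAbs : ℝ) =
        ((nonzeroEquiv E a).1.1 : ℝ) ^ 2 + d * ((nonzeroEquiv E a).1.2 : ℝ) ^ 2 := by
      have h : Algebra.norm ℤ a.1 =
        (nonzeroEquiv E a).1.1 ^ 2 + d * (nonzeroEquiv E a).1.2 ^ 2 := hnorm a.1
      rw [h, Nat.cast_natAbs, abs_of_nonneg (by positivity)]
      push_cast
      rfl
    rw [← hN, Complex.ofReal_mul, Complex.ofReal_one, one_mul,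
      Complex.mul_cpow_ofReal_nonneg (by positivity) (by positivity)]
    push_cast
    rfl
  · rw [hr1, hr2, pow_one, pow_zero]
    push_cast
    simp only [one_mul]
    ring

end DedekindXi

theorem mainTheorem1 (K : Type*) [Field K] [NumberField K]
    (hK : Nonempty (K ≃+* ℚ) ∨
      (∃ α : K, α ^ 2 = -1 ∧ IntermediateField.adjoin ℚ {α} = ⊤) ∨
      (∃ α : K, α ^ 2 = -2 ∧ IntermediateField.adjoin ℚ {α} = ⊤)) :
    DedekindXi.IsXi K (DedekindXi.xi K) ∧
    ∃ (Ω : Type) (_ : MeasurableSpace Ω) (P : MeasureTheory.Measure Ω) (X : Ω → ℝ),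
      MeasureTheory.IsProbabilityMeasure P ∧
      Measurable X ∧
      (∀ ω, 0 < X ω) ∧
      (P.map X).AbsolutelyContinuous MeasureTheory.volume ∧
      ∀ s : ℂ,
        MeasureTheory.Integrable (fun ω => (X ω : ℂ) ^ s) P ∧
        ∫ ω, (X ω : ℂ) ^ s ∂P =
          ((|NumberField.discr K| : ℤ) : ℂ) ^ (-s / 2) * DedekindXi.xi K s := by
  rcases hK with ⟨⟨e⟩⟩ | ⟨α, hα, ht⟩ | ⟨α, hα, ht⟩
  · exact DedekindXi.exists_random_variable_of_equiv_rat e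
  · exact DedekindXi.exists_random_variable_of_sq_neg (d := 1) (Or.inl rfl) (by simpa using hα) ht
  · exact DedekindXi.exists_random_variable_of_sq_neg (d := 2) (Or.inr rfl) (by simpa using hα) ht
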